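/- Let $\mathcal{Y}$ be a separable real Banach space, $\mathcal{X}=\mathcal{Y}^*$ its dual, $\mathcal{H}$ a real Hilbert space, $A:\mathcal{X}\to\mathcal{H}$ bounded and linear, and $J:\mathcal{X}\to[0,\infty]$ convex, proper, weak$^*$ lower semicontinuous and absolutely one-homogeneous ($J(cu)=|c|J(u)$ for all $c\in\mathbb{R}$, $u\in\mathcal X$, with $0\cdot\infty=0$). Put $\mathcal{N}(J)=\{u: J(u)=0\}$ and $\mathrm{dom}(J)=\{u:J(u)<\infty\}$, and assume: 1. on $\mathcal{N}(J)$, $u\mapsto\|Au\|_{\mathcal H}$ is a norm equivalent to $\|\cdot\|_{\mathcal{X}}$; 2. there is $C>0$ with $\|u-\mathcal{P}^A(Au)\|_{\mathcal X}\le C\,J(u)$ for all $u\in\mathcal{X}$, where $\mathcal{P}^A(h)=\mathrm{argmin}_{v\in\mathcal{N}(J)}\|Av-h\|_{\mathcal H}$; 3. if $u_k\to u$ weakly$^*$ in $\mathcal X$, then $Au_k\to Au$ weakly in $\mathcal{H}$. Let $f\in\mathcal{H}$, $\alpha\ge2$, $\beta\ge1$, and for $t\ge0$ let $u_t$ denote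 a minimizer over $\mathcal{X}$ of $$E_t(u)=\tfrac1\alpha\|Au-f\|_{\mathcal H}^\alpha+\tfrac t\beta J(u)^\beta .$$ The subdifferential is $\partial J(u)=\{p\in\mathcal{X}^*: J(u)+\langle p,v-u\rangle\le J(v)\ \forall v\in\mathcal X\}$ for $u\in\mathrm{dom}(J)$, and $A^*q\in\mathcal X^*$ is given by $\langle A^*q,v\rangle=\langle q,Av\rangle_{\mathcal H}$. Consider the conditions * (RC) there is $u^\dagger\in\mathrm{dom}(J)$ with $Au^\dagger=f$; * (SC) there are $u^\dagger$ as in (RC) and $q\in\mathcal{H}$ with $A^*q\in\partial J(u^\dagger)$. Under (RC) let $J_{\min}=\inf\{J(u):u\in\mathrm{dom}(J),\,Au=f\}$ and $C_R=J_{\min}^{\beta/\alpha}$. Under (SC) let $s_*=\inf\{\|q\|_{\mathcal H}: q\in\mathcal H,\ A^*q\in\partial J(u)\text{ for some }u\in\mathrm{dom}(J)\text{ with }Au=f\}$ and $C_S=s_*^{1/(\alpha-1)}J_{\min}^{(\beta-1)/(\alpha-1)}$ (with $0^0=1$). Then for every $t>0$ minimizers $u_t$ exist and $Au_t$ does not depend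 on the choice of $u_t$. With $R(t)=\|Au_t-f\|_{\mathcal H}$, the forward solution path $t\mapsto Au_t$ satisfies: * it is Lipschitz continuous on $(\delta,\infty)$ for every $\delta>0$; * its derivative $(Au_t)'$ exists for almost every $t\in(0,\infty)$, and $\|(Au_t)'\|_{\mathcal H}\le \dfrac{R(t)}{t}\le\dfrac{\|f\|_{\mathcal H}}{t}$ there; * if (RC) holds, then $\|(Au_t)'\|_{\mathcal H}\le C_R\,t^{(1-\alpha)/\alpha}$ for almost every $t\in(0,\infty)$; * if (SC) holds (which includes (RC)), then $\|(Au_t)'\|_{\mathcal H}\le C_S\,t^{(2-\alpha)/(\alpha-1)}$ for almost every $t\in(0,\infty)$; * if $\alpha=2$ and (SC) holds, then $Au_0$ is also well defined, and $t\mapsto Au_t$ is Lipschitz continuous on $[0,\infty)$. -/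

import Mathlib

open Set Filter Topology MeasureTheory
open scoped NNReal ENNReal

noncomputable section

namespace VarReg

section General

variable {X H : Type*} [NormedAddCommGroup X] [NormedSpace ℝ X]
  [NormedAddCommGroup H] [InnerProductSpace ℝ H]

/-- The energy `E(u) = ‖A u - f‖ ^ α / α + (t / β) * J(u) ^ β`, with values in `[0, ∞]`. -/
def energy (A : X →L[ℝ] H) (J : X → ℝ≥0∞) (f : H) (α β t : ℝ) (u : X) : ℝ≥0∞ :=
  ENNReal.ofReal (‖A u - f‖ ^ α / α) + ENNReal.ofReal (t / β) * J u ^ β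

/-- The set `{A u : u is a global minimizer of the energy with parameter t}`. -/
def forwardSolutions (A : X →L[ℝ] H) (J : X → ℝ≥0∞) (f : H) (α β t : ℝ) : Set H :=
  A '' {u | ∀ v, energy A J f α β t u ≤ energy A J f α β t v}

/-- `J` is absolutely one-homogeneous (with the convention `0 * ∞ = 0`). -/
def AbsOneHomogeneous (J : X → ℝ≥0∞) : Prop :=
  ∀ (c : ℝ) (u : X), J (c • u) = ENNReal.ofReal |c| * J u

/-- On the null space of `J`, `u ↦ ‖A u‖` is a norm equivalent to the norm of `X`. -/
def NormEquivOnKernel (A : X →L[ℝ] H) (J : X → ℝ≥0∞) : Prop :=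
  ∃ c > 0, ∃ C > 0, ∀ u : X, J u = 0 → c * ‖u‖ ≤ ‖A u‖ ∧ ‖A u‖ ≤ C * ‖u‖

/-- `p` minimizes `u ↦ ‖A u - h‖` over the null space of `J`. -/
def IsKernelProj (A : X →L[ℝ] H) (J : X → ℝ≥0∞) (h : H) (p : X) : Prop :=
  J p = 0 ∧ ∀ u : X, J u = 0 → ‖A p - h‖ ≤ ‖A u - h‖

/-- The `A`-orthogonal projection onto the null space of `J`, that is, the minimizer of
`‖A u - h‖` over that null space (it exists and is unique in the setting in which it is used). -/
def kernelProj (A : X →L[ℝ] H) (J : X → ℝ≥0∞) (h : H) : X :=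
  Classical.epsilon (IsKernelProj A J h)

/-- The generalized Poincaré inequality. -/
def PoincareInequality (A : X →L[ℝ] H) (J : X → ℝ≥0∞) : Prop :=
  ∃ C : ℝ, 0 < C ∧
    ∀ u : X, ENNReal.ofReal ‖u - kernelProj A J (A u)‖ ≤ ENNReal.ofReal C * J u

/-- The subdifferential of `J` at `u` (empty outside of the effective domain). -/
def subdifferential (J : X → ℝ≥0∞) (u : X) : Set (StrongDual ℝ X) :=
  {p | J u ≠ ⊤ ∧ ∀ v : X, (J u : EReal) + ((p (v - u) : ℝ) : EReal) ≤ (J v : EReal)}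

/-- The element `A* q` of the dual of `X`, that is, `v ↦ ⟪q, A v⟫`. -/
def adjointApply (A : X →L[ℝ] H) (q : H) : StrongDual ℝ X :=
  (innerSL ℝ q).comp A

/-- `u` is a solution of `A u = f` in the effective domain of `J`. -/
def IsExactSolution (A : X →L[ℝ] H) (J : X → ℝ≥0∞) (f : H) (u : X) : Prop :=
  J u ≠ ⊤ ∧ A u = f

/-- The range condition. -/
def RangeCondition (A : X →L[ℝ] H) (J : X → ℝ≥0∞) (f : H) : Prop :=
  ∃ u : X, IsExactSolution A J f u

/-- The range condition and the source condition, for the same solution `u`. -/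
def RangeSourceCondition (A : X →L[ℝ] H) (J : X → ℝ≥0∞) (f : H) : Prop :=
  ∃ u : X, IsExactSolution A J f u ∧ ∃ q : H, adjointApply A q ∈ subdifferential J u

/-- The minimal value of `J` among the solutions of `A u = f`. -/
def Jmin (A : X →L[ℝ] H) (J : X → ℝ≥0∞) (f : H) : ℝ :=
  sInf {r : ℝ | ∃ u : X, IsExactSolution A J f u ∧ r = (J u).toReal}

/-- The infimum of the norms of all source elements of all exact solutions. -/
def sStar (A : X →L[ℝ] H) (J : X → ℝ≥0∞) (f : H) : ℝ :=
  sInf {r : ℝ | ∃ u : X, IsExactSolution A J f u ∧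
    ∃ q : H, adjointApply A q ∈ subdifferential J u ∧ r = ‖q‖}

/-- The constant under the range condition. -/
def constR (A : X →L[ℝ] H) (J : X → ℝ≥0∞) (f : H) (α β : ℝ) : ℝ :=
  Jmin A J f ^ (β / α)

/-- The constant under the range and source conditions. -/
def constS (A : X →L[ℝ] H) (J : X → ℝ≥0∞) (f : H) (α β : ℝ) : ℝ :=
  sStar A J f ^ (1 / (α - 1)) * Jmin A J f ^ ((β - 1) / (α - 1))

end General

section Dual

variable {Y H : Type*} [NormedAddCommGroup Y] [NormedSpace ℝ Y]
  [NormedAddCommGroup H] [InnerProductSpace ℝ H]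

/-- Lower semicontinuity for the weak-* topology of the dual of `Y`. -/
def WeakStarLSC (J : StrongDual ℝ Y → ℝ≥0∞) : Prop :=
  LowerSemicontinuous fun u : WeakDual ℝ Y => J (WeakDual.toStrongDual u)

/-- `A` maps weakly-* convergent sequences to weakly convergent sequences. -/
def WeakStarToWeakContinuous (A : StrongDual ℝ Y →L[ℝ] H) : Prop :=
  ∀ (u : ℕ → StrongDual ℝ Y) (v : StrongDual ℝ Y),
    (∀ y : Y, Tendsto (fun n => u n y) atTop (𝓝 (v y))) →
      ∀ h : H, Tendsto (fun n => inner ℝ h (A (u n))) atTop (𝓝 (inner ℝ h (A v)))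

end Dual

end VarReg

end

/-! Everything rests on one comparison. A minimizer `u` at parameter `t` satisfies `‖A u - f‖ ^ (α -
2) * ⟪f - A u, A v - A u⟫ ≤ t / β * (J v ^ β - J u ^ β)` whenever `J v` is finite. Testing the
inequalities at `s ≤ t` with each other's minimizer and weighting them by `t` and `s` cancels `J`.
Monotonicity of `x ↦ ‖x‖ ^ (α - 2) • x` then bounds the distance of the two forward solutions by `(t
- s) / s` times the residual at `s` (`minimizer_comparison`). Hence `A u_t` is unique (`s = t`), the
path is Lipschitz away from zero because residuals are at most `‖f‖`, and its derivative is at most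
`R t / t` wherever it exists.

The remaining rates are bounds on `R t`, obtained by testing with an exact solution `v`: this gives
`R ^ α ≤ t / β * (J v ^ β - J u ^ β)`. The range condition bounds the right side by `t * J v ^ β`; a
source element `q` gives `J v - J u ≤ ‖q‖ * R`, which cancels one power of `R`.

Two ingredients are independent of this: existence of minimizers, by the direct method, and almost
everywhere differentiability of Lipschitz curves in a Hilbert space. -/

namespace VarReg

/-! ### Differentiability of Lipschitz curves in a Hilbert space -/

section Rademacher

variable {H : Type*} [NormedAddCommGroup H] [InnerProductSpace ℝ H]

theorem countable_of_orthonormal [TopologicalSpace.SeparableSpace H]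
    {ι : Type*} {b : ι → H} (hb : Orthonormal ℝ b) : Countable ι := by
  refine Pairwise.countable_of_isOpen_disjoint (s := fun i => Metric.ball (b i) (1 / 2)) ?_
    (fun i => Metric.isOpen_ball) (fun i => Metric.nonempty_ball.2 (by norm_num))
  intro i j hij
  refine Metric.ball_disjoint_ball ?_
  have h1 : ‖b i - b j‖ ^ 2 = 2 := by
    rw [norm_sub_sq_real, hb.1 i, hb.1 j, hb.2 hij]
    norm_num
  rw [dist_eq_norm]
  nlinarith [norm_nonneg (b i - b j)]

theorem lipschitzWith_inner_left {g : ℝ → H} {K : ℝ≥0} (hg : LipschitzWith K g) (v : H) :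
    LipschitzWith (‖v‖₊ * K) fun s => inner ℝ v (g s) := by
  refine LipschitzWith.of_dist_le_mul fun x y => ?_
  rw [Real.dist_eq, ← inner_sub_right]
  calc |inner ℝ v (g x - g y)| ≤ ‖v‖ * ‖g x - g y‖ := abs_real_inner_le_norm _ _
    _ ≤ ‖v‖ * (K * dist x y) := by
        gcongr
        rw [← dist_eq_norm]
        exact hg.dist_le_mul x y
    _ = _ := by push_cast; ring

/-- Duality: for `v = ∑ d i • b i` the function `⟪v, g⟫` has derivative `‖v‖ ^ 2` at `t` and
Lipschitz constant `‖v‖ * K`, so `‖v‖ ≤ K`. -/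
theorem sum_sq_deriv_inner_le {g : ℝ → H} {K : ℝ≥0} (hg : LipschitzWith K g)
    {ι : Type*} {b : ι → H} (hb : Orthonormal ℝ b) (t : ℝ) (s : Finset ι) :
    ∑ i ∈ s, (deriv (fun r => inner ℝ (b i) (g r)) t) ^ 2 ≤ (K : ℝ) ^ 2 := by
  classical
  set d : ι → ℝ := fun i => deriv (fun r => inner ℝ (b i) (g r)) t with hd
  set v : H := ∑ i ∈ s, d i • b i with hv
  have hvn : ‖v‖ ^ 2 = ∑ i ∈ s, d i ^ 2 := by
    rw [← real_inner_self_eq_norm_sq, hv, hb.inner_sum]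
    simp [sq]
  have hder : HasDerivAt (fun r => inner ℝ v (g r)) (∑ i ∈ s, d i ^ 2) t := by
    have h1 : (fun r => inner ℝ v (g r)) = fun r => ∑ i ∈ s, d i * inner ℝ (b i) (g r) := by
      funext r
      simp [hv, sum_inner, real_inner_smul_left]
    rw [h1]
    refine HasDerivAt.fun_sum fun i _ => ?_
    by_cases hdi : DifferentiableAt ℝ (fun r => inner ℝ (b i) (g r)) t
    · simpa [sq] using hdi.hasDerivAt.const_mul (d i)
    -- The default value `0` of `deriv` removes this coordinate from `v`, so the bound holds at
    -- every `t`.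
    · have h0 : d i = 0 := deriv_zero_of_not_differentiableAt hdi
      simpa [h0] using hasDerivAt_const t (0 : ℝ)
  have h2 : ‖deriv (fun r => inner ℝ v (g r)) t‖ ≤ ‖v‖ * K := by
    simpa using norm_deriv_le_of_lipschitz (x₀ := t) (lipschitzWith_inner_left hg v)
  rw [hder.deriv, ← hvn, Real.norm_of_nonneg (sq_nonneg _)] at h2
  rw [← hvn]
  have h3 : ‖v‖ ≤ K := by
    by_contra! h
    have h0 : (0 : ℝ) ≤ K := K.2
    nlinarith
  gcongr

/-- A Lipschitz curve in a separable Hilbert space is differentiable almost everywhere. -/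
theorem ae_differentiableAt_of_lipschitzWith_of_separable [CompleteSpace H]
    [TopologicalSpace.SeparableSpace H] {g : ℝ → H} {K : ℝ≥0} (hg : LipschitzWith K g) :
    ∀ᵐ t, DifferentiableAt ℝ g t := by
  obtain ⟨w, b, -⟩ := exists_hilbertBasis ℝ H
  have : Countable w := countable_of_orthonormal b.orthonormal
  set d : ℝ → w → ℝ := fun t i => deriv (fun r => inner ℝ (b i) (g r)) t with hd
  have hmem : ∀ t, Memℓp (d t) 2 := fun t => by
    refine memℓp_gen' (C := (K : ℝ) ^ 2) fun s => ?_
    simpa using sum_sq_deriv_inner_le hg b.orthonormal t s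
  -- The candidate derivative, assembled from the coordinate derivatives; it is defined and bounded
  -- by `K` at every `t`, so that `g` can be recovered as its integral.
  set G : ℝ → H := fun t => b.repr.symm ⟨d t, hmem t⟩ with hG
  have hGi : ∀ t i, inner ℝ (b i) (G t) = d t i := fun t i => by
    rw [← b.repr_apply_apply, hG]
    simp
  have hGnorm : ∀ t, ‖G t‖ ≤ K := fun t => by
    have h1 : ‖G t‖ = ‖(⟨d t, hmem t⟩ : lp (fun _ : w => ℝ) 2)‖ := by simp [hG]
    rw [h1]
    refine lp.norm_le_of_forall_sum_le (by norm_num) K.2 fun s => ?_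
    simpa using sum_sq_deriv_inner_le hg b.orthonormal t s
  have hGmeas : StronglyMeasurable G := by
    refine stronglyMeasurable_of_tendsto (atTop : Filter (Finset w))
      (f := fun s t => ∑ i ∈ s, d t i • b i) (fun s => ?_) ?_
    · refine Finset.stronglyMeasurable_fun_sum s fun i _ => ?_
      exact (stronglyMeasurable_deriv _).smul_const _
    · rw [tendsto_pi_nhds]
      intro t
      exact b.hasSum_repr_symm ⟨d t, hmem t⟩
  have hGloc : LocallyIntegrable G volume := by
    refine (locallyIntegrable_const (K : ℝ)).mono hGmeas.aestronglyMeasurable ?_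
    filter_upwards with t
    simpa using hGnorm t
  have hint : ∀ a c : ℝ, IntervalIntegrable G volume a c := fun a c =>
    intervalIntegrable_iff.mpr
      ((hGloc.integrableOn_isCompact isCompact_uIcc).mono_set uIoc_subset_uIcc)
  -- Checked coordinatewise: scalar Lipschitz functions are absolutely continuous.
  have hFTC : ∀ t, g t = g 0 + ∫ s in (0 : ℝ)..t, G s := fun t => by
    apply b.repr.injective
    ext i
    rw [b.repr_apply_apply, b.repr_apply_apply, inner_add_right]
    have h1 := (innerSL ℝ (b i)).intervalIntegral_comp_comm (hint 0 t)
    have h2 : AbsolutelyContinuousOnInterval (fun r => inner ℝ (b i) (g r)) 0 t :=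
      (lipschitzWith_inner_left hg (b i)).lipschitzOnWith.absolutelyContinuousOnInterval
    have h3 := h2.integral_deriv_eq_sub
    simp only [innerSL_apply_apply, hGi] at h1
    rw [← h1, hd, h3]
    ring
  filter_upwards [LocallyIntegrable.ae_hasDerivAt_integral hGloc] with t ht
  have : HasDerivAt g (G t) t := by
    rw [show g = fun t => g 0 + ∫ s in (0 : ℝ)..t, G s from funext hFTC]
    exact (ht 0).const_add _
  exact this.differentiableAt

/-- A Lipschitz curve in a Hilbert space is differentiable almost everywhere. -/
theorem ae_differentiableAt_of_lipschitzWith [CompleteSpace H]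
    {g : ℝ → H} {K : ℝ≥0} (hg : LipschitzWith K g) :
    ∀ᵐ t, DifferentiableAt ℝ g t := by
  -- The range of a continuous curve is separable, hence so is its closed span.
  set S : Submodule ℝ H := (Submodule.span ℝ (range g)).topologicalClosure with hS
  have hgS : ∀ t, g t ∈ S := fun t =>
    Submodule.le_topologicalClosure _ (Submodule.subset_span (mem_range_self t))
  have hsep : TopologicalSpace.IsSeparable (S : Set H) :=
    (TopologicalSpace.isSeparable_range hg.continuous).span.closure
  have : TopologicalSpace.SeparableSpace S := hsep.separableSpace
  have : CompleteSpace S := (Submodule.isClosed_topologicalClosure _).completeSpace_coe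
  have hg' : LipschitzWith K fun t => (⟨g t, hgS t⟩ : S) := fun x y => hg x y
  filter_upwards [ae_differentiableAt_of_lipschitzWith_of_separable hg'] with t ht
  exact S.subtypeL.differentiableAt.comp t ht

end Rademacher

end VarReg

noncomputable section

namespace VarReg

/-! ### The null space of `J` and coercivity -/

section Homogeneous

variable {X H : Type*} [NormedAddCommGroup X] [NormedSpace ℝ X]
  [NormedAddCommGroup H] [InnerProductSpace ℝ H]

theorem AbsOneHomogeneous.map_zero {J : X → ℝ≥0∞} (hJ : AbsOneHomogeneous J) : J 0 = 0 := by
  simpa using hJ 0 0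

/-- Convexity at the midpoint of `2 • u` and `2 • v`. -/
theorem AbsOneHomogeneous.map_add_le {J : X → ℝ≥0∞} (hJ : AbsOneHomogeneous J)
    (hconv : ConvexOn ℝ≥0 univ J) (u v : X) : J (u + v) ≤ J u + J v := by
  have h2 : ∀ w : X, (2⁻¹ : ℝ≥0) • J ((2 : ℝ) • w) = J w := fun w => by
    rw [hJ, ENNReal.smul_def, smul_eq_mul, ← mul_assoc]
    rw [abs_of_pos two_pos, ENNReal.coe_inv two_ne_zero]
    simp [ENNReal.inv_mul_cancel]
  have h := hconv.2 (mem_univ ((2 : ℝ) • u)) (mem_univ ((2 : ℝ) • v))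
    (zero_le (a := (2⁻¹ : ℝ≥0))) (zero_le (a := (2⁻¹ : ℝ≥0))) (by rw [← two_mul]; simp)
  rw [h2, h2] at h
  have h3 : (2⁻¹ : ℝ≥0) • (2 : ℝ) • u + (2⁻¹ : ℝ≥0) • (2 : ℝ) • v = u + v := by
    rw [← smul_add, ← smul_add, NNReal.smul_def, smul_smul]
    simp
  rwa [h3] at h

/-- The null space of a convex absolutely one-homogeneous functional. -/
def kernelSubmodule (J : X → ℝ≥0∞) (hJ : AbsOneHomogeneous J) (hconv : ConvexOn ℝ≥0 univ J) :
    Submodule ℝ X where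
  carrier := {u | J u = 0}
  add_mem' {u v} hu hv := by
    have := hJ.map_add_le hconv u v
    simp only [mem_ofPred_eq] at hu hv ⊢
    simpa [hu, hv] using this
  zero_mem' := hJ.map_zero
  smul_mem' c u hu := by
    simp only [mem_ofPred_eq] at hu ⊢
    rw [hJ, hu, mul_zero]

/-- `A` is bounded below on the null space, so the image of this complete space is complete and has
a nearest point to `h`. This makes `kernelProj` a genuine minimizer and not an arbitrary choice. -/
theorem exists_isKernelProj [CompleteSpace X] {A : X →L[ℝ] H} {J : X → ℝ≥0∞}
    (hJ : AbsOneHomogeneous J) (hconv : ConvexOn ℝ≥0 univ J) (hA : NormEquivOnKernel A J)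
    (hclosed : IsClosed {u | J u = 0}) (h : H) : ∃ p, IsKernelProj A J h p := by
  obtain ⟨c, hc, _, _, hcA⟩ := hA
  set N := kernelSubmodule J hJ hconv with hN
  have : CompleteSpace N := hclosed.isComplete.completeSpace_coe
  set B : N →L[ℝ] H := A.comp N.subtypeL with hB
  have hanti : AntilipschitzWith ⟨c⁻¹, (inv_pos.2 hc).le⟩ B := by
    refine ContinuousLinearMap.antilipschitz_of_bound _ fun x => ?_
    have := (hcA x x.2).1
    change ‖(x : X)‖ ≤ c⁻¹ * ‖A x‖
    rw [inv_mul_eq_div, le_div_iff₀ hc]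
    linarith
  have hcompl : IsComplete (LinearMap.range (B : N →ₗ[ℝ] H) : Set H) := by
    have := hanti.isComplete_range B.uniformContinuous
    exact this
  obtain ⟨y, ⟨p, rfl⟩, hp⟩ := Submodule.exists_norm_eq_iInf_of_complete_subspace _ hcompl h
  refine ⟨p, p.2, fun u hu => ?_⟩
  have h1 : ‖h - A p‖ ≤ ‖h - A u‖ := by
    change ‖h - A p‖ = _ at hp
    rw [hp]
    refine ciInf_le (f := fun w : (LinearMap.range (B : N →ₗ[ℝ] H) : Set H) => ‖h - w‖)
      ⟨0, ?_⟩ ⟨A u, ⟨⟨u, hu⟩, rfl⟩⟩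
    rintro _ ⟨w, rfl⟩
    exact norm_nonneg _
  rwa [norm_sub_rev, norm_sub_rev (A u)]

/-- Boundedness of `A u` and of `J u` implies boundedness of `u`. -/
theorem exists_norm_le_of_bound [CompleteSpace X] {A : X →L[ℝ] H} {J : X → ℝ≥0∞}
    (hJ : AbsOneHomogeneous J) (hconv : ConvexOn ℝ≥0 univ J) (hA : NormEquivOnKernel A J)
    (hP : PoincareInequality A J) (hclosed : IsClosed {u | J u = 0}) (a : ℝ) {r : ℝ≥0∞}
    (hr : r ≠ ⊤) : ∃ M : ℝ, ∀ u, ‖A u‖ ≤ a → J u ≤ r → ‖u‖ ≤ M := by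
  have hA' := hA
  obtain ⟨c, hc, _, _, hcA⟩ := hA'
  obtain ⟨C, hC, hCP⟩ := hP
  -- The Poincaré inequality controls `u - p`. For the projection `p`, the competitor `0` gives `‖A
  -- p - A u‖ ≤ ‖A u‖`, hence `c * ‖p‖ ≤ ‖A p‖ ≤ 2 * a`.
  refine ⟨C * r.toReal + 2 * a / c, fun u hu hJu => ?_⟩
  have hp : IsKernelProj A J (A u) (kernelProj A J (A u)) :=
    Classical.epsilon_spec (exists_isKernelProj hJ hconv hA hclosed (A u))
  set p := kernelProj A J (A u) with hpdef
  have h1 : ‖u - p‖ ≤ C * r.toReal := by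
    have h2 := (hCP u).trans (mul_le_mul_right hJu _)
    have h3 := ENNReal.toReal_mono (ENNReal.mul_ne_top ENNReal.ofReal_ne_top hr) h2
    rwa [ENNReal.toReal_mul, ENNReal.toReal_ofReal (norm_nonneg _),
      ENNReal.toReal_ofReal hC.le] at h3
  have h4 : ‖p‖ ≤ 2 * a / c := by
    rw [le_div_iff₀ hc]
    have h5 := hp.2 0 hJ.map_zero
    rw [map_zero, zero_sub, norm_neg] at h5
    have h6 := (hcA p hp.1).1
    have h7 : ‖A p‖ ≤ ‖A p - A u‖ + ‖A u‖ := by simpa using norm_add_le (A p - A u) (A u)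
    linarith
  calc ‖u‖ = ‖(u - p) + p‖ := by simp
    _ ≤ ‖u - p‖ + ‖p‖ := norm_add_le _ _
    _ ≤ _ := add_le_add h1 h4

theorem energy_zero_ne_top {A : X →L[ℝ] H} {J : X → ℝ≥0∞} (hJ : AbsOneHomogeneous J)
    {f : H} {α β t : ℝ} (hβ : 1 ≤ β) : energy A J f α β t 0 ≠ ⊤ := by
  simp [energy, hJ.map_zero, ENNReal.zero_rpow_of_pos (zero_lt_one.trans_le hβ)]

theorem norm_le_of_energy_le {A : X →L[ℝ] H} {J : X → ℝ≥0∞} {f : H} {α β t : ℝ} (hα : 0 < α)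
    {m : ℝ≥0∞} (hm : m ≠ ⊤) {u : X} (hu : energy A J f α β t u ≤ m) :
    ‖A u - f‖ ≤ (α * m.toReal) ^ (1 / α) := by
  have h1 : ENNReal.ofReal (‖A u - f‖ ^ α / α) ≤ m := le_self_add.trans hu
  have h2 := (ENNReal.ofReal_le_iff_le_toReal hm).1 h1
  rw [div_le_iff₀ hα, mul_comm] at h2
  rw [one_div]
  exact (Real.le_rpow_inv_iff_of_pos (norm_nonneg _) (by positivity) hα).2 h2

theorem le_of_energy_le {A : X →L[ℝ] H} {J : X → ℝ≥0∞} {f : H} {α β t : ℝ} (hβ : 0 < β)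
    (ht : 0 < t) {m : ℝ≥0∞} {u : X} (hu : energy A J f α β t u ≤ m) :
    J u ≤ (m / ENNReal.ofReal (t / β)) ^ (1 / β) := by
  have h1 : ENNReal.ofReal (t / β) * J u ^ β ≤ m := le_add_self.trans hu
  rw [one_div, ENNReal.le_rpow_inv_iff hβ, ENNReal.le_div_iff_mul_le
    (Or.inl (by simpa using div_pos ht hβ)) (Or.inl ENNReal.ofReal_ne_top), mul_comm]
  exact h1

end Homogeneous

/-! ### Existence of minimizers by the direct method -/

section Existence

variable {Y H : Type*} [NormedAddCommGroup Y] [NormedSpace ℝ Y]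
  [NormedAddCommGroup H] [InnerProductSpace ℝ H]

theorem WeakStarLSC.isClosed_kernel {J : StrongDual ℝ Y → ℝ≥0∞} (hJ : WeakStarLSC J) :
    IsClosed {u | J u = 0} := by
  have h1 : IsClosed {u : WeakDual ℝ Y | J (WeakDual.toStrongDual u) = 0} := by
    have := hJ.isClosed_preimage 0
    convert this using 1
    ext u
    simp
  exact h1.preimage NormedSpace.Dual.toWeakDual_continuous

/-- Weak lower semicontinuity of the norm: pair with the fixed vector `A v - f` and use
Cauchy–Schwarz. -/
theorem WeakStarToWeakContinuous.norm_sub_le {A : StrongDual ℝ Y →L[ℝ] H}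
    (hA : WeakStarToWeakContinuous A) {u : ℕ → StrongDual ℝ Y} {v : StrongDual ℝ Y}
    (huv : ∀ y : Y, Tendsto (fun n => u n y) atTop (𝓝 (v y))) {f : H} {a : ℝ}
    (ha : Tendsto (fun n => ‖A (u n) - f‖) atTop (𝓝 a)) : ‖A v - f‖ ≤ a := by
  have h1 := hA u v huv (A v - f)
  have h2 : Tendsto (fun n => inner ℝ (A v - f) (A (u n) - f)) atTop
      (𝓝 (inner ℝ (A v - f) (A v - f))) := by
    simp only [inner_sub_right]
    simpa only [inner_sub_right] using h1.sub_const (inner ℝ (A v - f) f)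
  have h3 := le_of_tendsto_of_tendsto' h2 (ha.const_mul ‖A v - f‖)
    fun n => real_inner_le_norm _ _
  rw [real_inner_self_eq_norm_sq] at h3
  have h0 : 0 ≤ a := ge_of_tendsto' ha fun n => norm_nonneg _
  by_contra! h
  nlinarith

theorem WeakStarLSC.le_of_tendsto {J : StrongDual ℝ Y → ℝ≥0∞} (hJ : WeakStarLSC J)
    {u : ℕ → WeakDual ℝ Y} {v : WeakDual ℝ Y} (huv : Tendsto u atTop (𝓝 v)) {j : ℝ≥0∞}
    (hj : Tendsto (fun n => J (WeakDual.toStrongDual (u n))) atTop (𝓝 j)) :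
    J (WeakDual.toStrongDual v) ≤ j := by
  refine le_of_forall_lt fun y hy => ?_
  obtain ⟨z, hyz, hz⟩ := exists_between hy
  exact hyz.trans_le (ge_of_tendsto hj ((huv.eventually (hJ v z hz)).mono fun n hn => hn.le))

theorem exists_minimizer [TopologicalSpace.SeparableSpace Y]
    {A : StrongDual ℝ Y →L[ℝ] H} {J : StrongDual ℝ Y → ℝ≥0∞}
    (hJ_convex : ConvexOn ℝ≥0 univ J) (hJ_hom : AbsOneHomogeneous J) (hJ_lsc : WeakStarLSC J)
    (hA_norm : NormEquivOnKernel A J) (hA_poincare : PoincareInequality A J)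
    (hA_cont : WeakStarToWeakContinuous A) (f : H) {α β t : ℝ} (hα : 0 < α) (hβ : 1 ≤ β)
    (ht : 0 < t) : ∃ u, ∀ v, energy A J f α β t u ≤ energy A J f α β t v := by
  have hβ0 : 0 < β := zero_lt_one.trans_le hβ
  set E := energy A J f α β t with hE
  set m : ℝ≥0∞ := ⨅ v, E v with hm
  have hmtop : m ≠ ⊤ := ne_top_of_le_ne_top (energy_zero_ne_top hJ_hom hβ) (iInf_le E 0)
  have hex : ∀ n : ℕ, ∃ v, E v < m + ((n : ℝ≥0∞) + 1)⁻¹ := fun n =>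
    iInf_lt_iff.1 (ENNReal.lt_add_right hmtop (by simp))
  choose u hu using hex
  have hbd : ∀ n, E (u n) ≤ m + 1 := fun n => (hu n).le.trans (by gcongr; simp)
  have hlim : Tendsto (fun n => E (u n)) atTop (𝓝 m) := by
    refine tendsto_of_tendsto_of_tendsto_of_le_of_le tendsto_const_nhds ?_
      (fun n => iInf_le E (u n)) (fun n => (hu n).le)
    have h1 : Tendsto (fun n : ℕ => ((n : ℝ≥0∞) + 1)⁻¹) atTop (𝓝 0) := by
      have := (tendsto_add_atTop_iff_nat 1).2 ENNReal.tendsto_inv_nat_nhds_zero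
      simpa using this
    simpa using h1.const_add m
  have hm1 : m + 1 ≠ ⊤ := by simp [hmtop]
  set a : ℝ := (α * (m + 1).toReal) ^ (1 / α) with ha
  have hAu : ∀ n, ‖A (u n) - f‖ ≤ a := fun n => norm_le_of_energy_le hα hm1 (hbd n)
  set r : ℝ≥0∞ := ((m + 1) / ENNReal.ofReal (t / β)) ^ (1 / β) with hr
  have hrtop : r ≠ ⊤ := by
    refine ENNReal.rpow_ne_top_of_nonneg (by positivity) (ENNReal.div_ne_top hm1 ?_)
    simpa using div_pos ht hβ0
  have hJu : ∀ n, J (u n) ≤ r := fun n => le_of_energy_le hβ0 ht (hbd n)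
  obtain ⟨M, hM⟩ := exists_norm_le_of_bound hJ_hom hJ_convex hA_norm hA_poincare
    hJ_lsc.isClosed_kernel (a + ‖f‖) hrtop
  have huM : ∀ n, ‖u n‖ ≤ M := fun n => hM _ (by
    have := norm_add_le (A (u n) - f) f
    rw [sub_add_cancel] at this
    linarith [hAu n]) (hJu n)
  -- Separability of `Y` makes bounded balls weak-* sequentially compact. Two further extractions
  -- make the residual norms and the values of `J` converge separately, so the limit energy is
  -- explicit.
  obtain ⟨v, -, φ, hφ, hv⟩ := WeakDual.isSeqCompact_closedBall ℝ Y 0 M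
    (x := fun n => StrongDual.toWeakDual (u n)) (fun n => by simpa using huM n)
  obtain ⟨b, -, χ, hχ, hb⟩ := (isCompact_Icc (a := (0 : ℝ)) (b := a)).isSeqCompact
    (x := fun n => ‖A (u (φ n)) - f‖) (fun n => ⟨norm_nonneg _, hAu _⟩)
  obtain ⟨j, -, ξ, hξ, hj⟩ := (isCompact_univ (X := ℝ≥0∞)).isSeqCompact
    (x := fun n => J (u (φ (χ n)))) (fun n => mem_univ _)
  have hvξ := hv.comp (hχ.tendsto_atTop.comp hξ.tendsto_atTop)
  have hbξ := hb.comp hξ.tendsto_atTop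
  have hJv : J (WeakDual.toStrongDual v) ≤ j := hJ_lsc.le_of_tendsto hvξ hj
  have hAv : ‖A (WeakDual.toStrongDual v) - f‖ ≤ b :=
    hA_cont.norm_sub_le (fun y => ((WeakDual.eval_continuous y).tendsto v).comp hvξ) hbξ
  have hlim' : Tendsto (fun n => E (u (φ (χ (ξ n))))) atTop
      (𝓝 (ENNReal.ofReal (b ^ α / α) + ENNReal.ofReal (t / β) * j ^ β)) := by
    refine Tendsto.add ?_ ?_
    · exact ENNReal.tendsto_ofReal ((hbξ.rpow_const (Or.inr hα.le)).div_const α)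
    · exact ENNReal.Tendsto.const_mul ((ENNReal.continuous_rpow_const.tendsto j).comp hj)
        (Or.inr ENNReal.ofReal_ne_top)
  have hmeq := tendsto_nhds_unique hlim'
    (hlim.comp (hφ.tendsto_atTop.comp (hχ.tendsto_atTop.comp hξ.tendsto_atTop)))
  refine ⟨WeakDual.toStrongDual v, fun w => le_trans ?_ (iInf_le E w)⟩
  rw [← hm, ← hmeq]
  simp only [hE, energy]
  gcongr

end Existence

end VarReg

end

noncomputable section

namespace VarReg

/-! ### Monotonicity of the duality map at two scales -/

section InnerProduct

variable {H : Type*} [NormedAddCommGroup H] [InnerProductSpace ℝ H]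

/-- Strong monotonicity of the scaled duality map `x ↦ ‖x‖ ^ γ • x`, compared at two scales. -/
theorem norm_sub_le_of_scaled_monotone {a b : H} {γ s t : ℝ} (hγ : 0 ≤ γ) (hs : 0 < s)
    (hst : s ≤ t)
    (h : s * (‖a‖ ^ γ * inner ℝ a (a - b)) ≤ t * (‖b‖ ^ γ * inner ℝ b (a - b))) :
    ‖b‖ ≤ ‖a‖ ∧ ‖a - b‖ ≤ (t - s) / s * ‖b‖ := by
  set P := ‖a‖ ^ γ with hP
  set Q := ‖b‖ ^ γ with hQ
  have hP0 : 0 ≤ P := by positivity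
  have hQ0 : 0 ≤ Q := by positivity
  have hD : ‖a - b‖ ^ 2 = ‖a‖ ^ 2 - 2 * inner ℝ a b + ‖b‖ ^ 2 := norm_sub_sq_real a b
  -- Polarization, chosen so that `P * ⟪a, a - b⟫ - Q * ⟪b, a - b⟫` becomes half of `(P + Q) * ‖a -
  -- b‖ ^ 2 + (P - Q) * (‖a‖ ^ 2 - ‖b‖ ^ 2)`, whose second term is nonnegative.
  have ha : inner ℝ a (a - b) = (‖a - b‖ ^ 2 + (‖a‖ ^ 2 - ‖b‖ ^ 2)) / 2 := by
    rw [inner_sub_right, real_inner_self_eq_norm_sq, hD]; ring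
  have hb : inner ℝ b (a - b) = (-‖a - b‖ ^ 2 + (‖a‖ ^ 2 - ‖b‖ ^ 2)) / 2 := by
    rw [inner_sub_right, real_inner_self_eq_norm_sq, hD, real_inner_comm]; ring
  -- If `‖a‖ < ‖b‖`, then `⟪b, a - b⟫ ≤ 0`, so `t` may be lowered to `s` in `h`; monotonicity at a
  -- single scale then contradicts `a ≠ b`.
  have hmono : ‖b‖ ≤ ‖a‖ := by
    by_contra! hlt
    have hb0 : 0 < ‖b‖ := (norm_nonneg a).trans_lt hlt
    have hQpos : 0 < Q := Real.rpow_pos_of_pos hb0 γ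
    have hPQ : P ≤ Q := Real.rpow_le_rpow (norm_nonneg a) hlt.le hγ
    have hsq : ‖a‖ ^ 2 - ‖b‖ ^ 2 < 0 := by nlinarith [norm_nonneg a]
    have hDpos : 0 < ‖a - b‖ ^ 2 := by
      have : 0 < ‖a - b‖ := norm_pos_iff.2 (sub_ne_zero.2 fun h => by simp [h] at hlt)
      positivity
    have hbneg : inner ℝ b (a - b) ≤ 0 := by rw [hb]; nlinarith
    have h1 : t * (Q * inner ℝ b (a - b)) ≤ s * (Q * inner ℝ b (a - b)) :=
      mul_le_mul_of_nonpos_right hst (mul_nonpos_of_nonneg_of_nonpos hQ0 hbneg)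
    have h2 : P * inner ℝ a (a - b) ≤ Q * inner ℝ b (a - b) :=
      le_of_mul_le_mul_left (h.trans h1) hs
    rw [ha, hb] at h2
    have h3 : 0 ≤ (P - Q) * (‖a‖ ^ 2 - ‖b‖ ^ 2) :=
      mul_nonneg_of_nonpos_of_nonpos (by linarith) hsq.le
    have h4 : 0 < (P + Q) * ‖a - b‖ ^ 2 := by positivity
    linarith
  refine ⟨hmono, ?_⟩
  -- For `b = 0` the factor `Q` may vanish and cannot be cancelled, but `h` then forces `a = 0`.
  rcases eq_or_lt_of_le (norm_nonneg (b : H)) with hb0 | hb0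
  · have hbz : b = 0 := norm_eq_zero.1 hb0.symm
    subst hbz
    simp only [sub_zero, inner_zero_left, mul_zero, norm_zero, real_inner_self_eq_norm_sq] at h ⊢
    by_contra! hpos
    have : 0 < P := Real.rpow_pos_of_pos hpos γ
    have : 0 < s * (P * ‖a‖ ^ 2) := by positivity
    linarith
  · have hQpos : 0 < Q := Real.rpow_pos_of_pos hb0 γ
    have hPQ : Q ≤ P := Real.rpow_le_rpow (norm_nonneg b) hmono hγ
    have h1 : s * (P * inner ℝ a (a - b) - Q * inner ℝ b (a - b)) ≤
        (t - s) * (Q * (‖b‖ * ‖a - b‖)) := by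
      have h2 : (t - s) * (Q * inner ℝ b (a - b)) ≤ (t - s) * (Q * (‖b‖ * ‖a - b‖)) := by
        have := real_inner_le_norm b (a - b)
        have : 0 ≤ t - s := by linarith
        gcongr
      linarith
    have h3 : Q * ‖a - b‖ ^ 2 ≤ P * inner ℝ a (a - b) - Q * inner ℝ b (a - b) := by
      rw [ha, hb]
      have h4 : 0 ≤ (P - Q) * (‖a‖ ^ 2 - ‖b‖ ^ 2) :=
        mul_nonneg (by linarith) (by nlinarith [norm_nonneg b])
      have h5 : 0 ≤ (P - Q) * ‖a - b‖ ^ 2 := mul_nonneg (by linarith) (sq_nonneg _)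
      linarith
    have h6 : s * (Q * ‖a - b‖ ^ 2) ≤ (t - s) * (Q * (‖b‖ * ‖a - b‖)) :=
      (mul_le_mul_of_nonneg_left h3 hs.le).trans h1
    have h7 : s * ‖a - b‖ ^ 2 ≤ (t - s) * (‖b‖ * ‖a - b‖) :=
      le_of_mul_le_mul_left (by linarith) hQpos
    rw [div_mul_eq_mul_div, le_div_iff₀ hs]
    rcases eq_or_lt_of_le (norm_nonneg (a - b)) with hd | hd
    · rw [← hd, zero_mul]
      exact mul_nonneg (by linarith) hb0.le
    · refine le_of_mul_le_mul_right ?_ hd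
      linarith

end InnerProduct

theorem rpow_sub_two_mul_sq {x α : ℝ} (hx : 0 ≤ x) (hα : 0 < α) :
    x ^ (α - 2) * x ^ 2 = x ^ α := by
  rcases eq_or_lt_of_le hx with rfl | hx
  · simp [Real.zero_rpow hα.ne']
  · rw [← Real.rpow_natCast x 2, ← Real.rpow_add hx]
    norm_num

/-- The tangent-line inequality at `x` for the convex function `r ↦ r ^ β`. -/
theorem rpow_sub_rpow_le {x y β : ℝ} (hx : 0 ≤ x) (hy : 0 ≤ y) (hβ : 1 ≤ β) :
    x ^ β - y ^ β ≤ β * x ^ (β - 1) * (x - y) := by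
  have hconv := convexOn_rpow hβ
  have hder := Real.hasDerivAt_rpow_const (x := x) (p := β) (Or.inr hβ)
  rcases lt_trichotomy x y with h | rfl | h
  · have := hconv.le_slope_of_hasDerivAt hx hy h hder
    rw [slope_def_field, le_div_iff₀ (by linarith)] at this
    linarith
  · simp
  · have := hconv.slope_le_of_hasDerivAt hy hx h hder
    rw [slope_def_field, div_le_iff₀ (by linarith)] at this
    linarith

/-! ### Optimality, comparison and residual bounds -/

section Minimizers

variable {X H : Type*} [NormedAddCommGroup X] [NormedSpace ℝ X]
  [NormedAddCommGroup H] [InnerProductSpace ℝ H]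
  {A : X →L[ℝ] H} {J : X → ℝ≥0∞} {f : H} {α β t : ℝ}

theorem energy_eq_ofReal (hα : 0 < α) (hβ : 0 < β) (ht : 0 ≤ t) {u : X} (hu : J u ≠ ⊤) :
    energy A J f α β t u = ENNReal.ofReal (‖A u - f‖ ^ α / α + t / β * (J u).toReal ^ β) := by
  rw [energy, ENNReal.ofReal_add (by positivity) (by positivity),
    ENNReal.ofReal_mul (by positivity), ← ENNReal.ofReal_rpow_of_nonneg (by positivity) hβ.le,
    ENNReal.ofReal_toReal hu]

theorem ne_top_of_energy_ne_top (hβ : 0 < β) (ht : 0 < t) {u : X}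
    (hu : energy A J f α β t u ≠ ⊤) : J u ≠ ⊤ := by
  intro h
  refine hu ?_
  rw [energy, h, ENNReal.top_rpow_of_pos hβ, ENNReal.mul_top, add_top]
  simpa using div_pos ht hβ

theorem convex_combination_ne_top_and_toReal_le (hconv : ConvexOn ℝ≥0 univ J) {u v : X}
    (hu : J u ≠ ⊤) (hv : J v ≠ ⊤) {l : ℝ} (hl0 : 0 ≤ l) (hl1 : l ≤ 1) :
    J (u + l • (v - u)) ≠ ⊤ ∧
      (J (u + l • (v - u))).toReal ≤ (1 - l) * (J u).toReal + l * (J v).toReal := by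
  lift l to ℝ≥0 using hl0
  obtain ⟨k, hk⟩ : ∃ k : ℝ≥0, (k : ℝ) = 1 - l := ⟨⟨1 - l, by linarith⟩, rfl⟩
  have h := hconv.2 (mem_univ u) (mem_univ v) (zero_le (a := k)) (zero_le (a := l))
    (by rw [← NNReal.coe_inj]; push_cast; linarith)
  have h1 : k • u + l • v = u + (l : ℝ) • (v - u) := by
    rw [NNReal.smul_def, NNReal.smul_def, hk]
    module
  rw [h1, ENNReal.smul_def, ENNReal.smul_def, smul_eq_mul, smul_eq_mul] at h
  have htop : (k : ℝ≥0∞) * J u + l * J v ≠ ⊤ :=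
    ENNReal.add_ne_top.2 ⟨ENNReal.mul_ne_top ENNReal.coe_ne_top hu,
      ENNReal.mul_ne_top ENNReal.coe_ne_top hv⟩
  refine ⟨ne_top_of_le_ne_top htop h, ?_⟩
  have h2 := ENNReal.toReal_mono htop h
  rw [ENNReal.toReal_add (ENNReal.mul_ne_top ENNReal.coe_ne_top hu)
    (ENNReal.mul_ne_top ENNReal.coe_ne_top hv), ENNReal.toReal_mul, ENNReal.toReal_mul] at h2
  simpa [hk] using h2

theorem minimizer_ne_top (hJ : AbsOneHomogeneous J) (hβ : 1 ≤ β) (ht : 0 < t) {u : X}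
    (hu : ∀ v, energy A J f α β t u ≤ energy A J f α β t v) : J u ≠ ⊤ :=
  ne_top_of_energy_ne_top (zero_lt_one.trans_le hβ) ht
    (ne_top_of_le_ne_top (energy_zero_ne_top hJ hβ) (hu 0))

/-- The first-order optimality condition, as a variational inequality. -/
theorem minimizer_variational_inequality (hconv : ConvexOn ℝ≥0 univ J)
    (hα : 1 < α) (hβ : 1 ≤ β) (ht : 0 < t) {u : X}
    (hu : ∀ v, energy A J f α β t u ≤ energy A J f α β t v) (huJ : J u ≠ ⊤)
    {v : X} (hv : J v ≠ ⊤) :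
    ‖A u - f‖ ^ (α - 2) * inner ℝ (f - A u) (A v - A u) ≤
      t / β * ((J v).toReal ^ β - (J u).toReal ^ β) := by
  have hβ0 : 0 < β := zero_lt_one.trans_le hβ
  have hα0 : 0 < α := zero_lt_one.trans hα
  set r := A u - f with hr
  set d := A v - A u with hd
  set K := t / β * ((J v).toReal ^ β - (J u).toReal ^ β) with hK
  -- Up to a constant, `ψ` dominates the energy along the segment from `u` to `v` and touches it at
  -- `l = 0`. Replacing `J ^ β` by its chord makes it differentiable there.
  set ψ : ℝ → ℝ := fun l => ‖r + l • d‖ ^ α / α + l * K with hψ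
  have hder : HasDerivAt ψ (‖r‖ ^ (α - 2) * inner ℝ r d + K) 0 := by
    have h1 : HasDerivAt (fun l : ℝ => r + l • d) d 0 := by
      simpa using ((hasDerivAt_id (0 : ℝ)).smul_const d).const_add r
    have h2 := (hasFDerivAt_norm_rpow (r + (0 : ℝ) • d) hα).comp_hasDerivAt (0 : ℝ) h1
    have h3 := (h2.div_const α).add ((hasDerivAt_id (0 : ℝ)).mul_const K)
    have h4 : ‖r‖ ^ (α - 2) * inner ℝ r d + K =
        ((α * ‖r + (0 : ℝ) • d‖ ^ (α - 2)) • innerSL ℝ (r + (0 : ℝ) • d)) d / α + 1 * K := by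
      simp only [zero_smul, add_zero, one_mul, smul_apply,
        innerSL_apply_apply, smul_eq_mul]
      field_simp
    rw [h4]
    exact h3
  have hmin : ∀ l : ℝ, 0 ≤ l → l ≤ 1 → ψ 0 ≤ ψ l := fun l hl0 hl1 => by
    obtain ⟨hw, hwJ⟩ := convex_combination_ne_top_and_toReal_le hconv huJ hv hl0 hl1
    have h1 := hu (u + l • (v - u))
    rw [energy_eq_ofReal hα0 hβ0 ht.le huJ, energy_eq_ofReal hα0 hβ0 ht.le hw,
      ENNReal.ofReal_le_ofReal_iff (by positivity)] at h1
    have h2 : A (u + l • (v - u)) - f = r + l • d := by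
      simp only [map_add, map_smul, map_sub, hr, hd]
      abel
    rw [h2] at h1
    have h3 : (J (u + l • (v - u))).toReal ^ β ≤
        (1 - l) * (J u).toReal ^ β + l * (J v).toReal ^ β := by
      refine (Real.rpow_le_rpow ENNReal.toReal_nonneg hwJ hβ0.le).trans ?_
      exact (convexOn_rpow hβ).2 ENNReal.toReal_nonneg ENNReal.toReal_nonneg
        (by linarith) hl0 (by ring)
    have h4 := mul_le_mul_of_nonneg_left h3 (div_pos ht hβ0).le
    simp only [hψ, zero_smul, add_zero, zero_mul, hK]
    linarith
  have hnonneg : 0 ≤ ‖r‖ ^ (α - 2) * inner ℝ r d + K := by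
    refine ge_of_tendsto hder.tendsto_slope_zero_right ?_
    filter_upwards [Ioc_mem_nhdsGT (zero_lt_one (α := ℝ))] with l hl
    have := hmin l hl.1.le hl.2
    rw [zero_add, smul_eq_mul]
    exact mul_nonneg (inv_nonneg.2 hl.1.le) (by linarith)
  have h5 : f - A u = -r := by rw [hr]; abel
  rw [h5, inner_neg_left]
  linarith

/-- Comparison of residuals of minimizers for two parameters. -/
theorem minimizer_comparison (hconv : ConvexOn ℝ≥0 univ J) (hJ : AbsOneHomogeneous J)
    (hα : 2 ≤ α) (hβ : 1 ≤ β) {s : ℝ} (hs : 0 < s) (hst : s ≤ t) {u v : X}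
    (hu : ∀ w, energy A J f α β t u ≤ energy A J f α β t w)
    (hv : ∀ w, energy A J f α β s v ≤ energy A J f α β s w) :
    ‖A u - A v‖ ≤ (t - s) / s * ‖A v - f‖ := by
  have ht : 0 < t := hs.trans_le hst
  have huJ := minimizer_ne_top hJ hβ ht hu
  have hvJ := minimizer_ne_top hJ hβ hs hv
  have h1 := minimizer_variational_inequality hconv (by linarith) hβ ht hu huJ hvJ
  have h2 := minimizer_variational_inequality hconv (by linarith) hβ hs hv hvJ huJ
  have h := norm_sub_le_of_scaled_monotone (a := A u - f) (b := A v - f) (γ := α - 2)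
    (by linarith) hs hst ?_
  · simpa using h.2
  · have e1 : inner ℝ (f - A u) (A v - A u) = inner ℝ (A u - f) (A u - f - (A v - f)) := by
      rw [← inner_neg_neg]; congr 1 <;> abel
    have e2 : inner ℝ (f - A v) (A u - A v) = -inner ℝ (A v - f) (A u - f - (A v - f)) := by
      rw [← inner_neg_left]; congr 1 <;> abel
    rw [e1] at h1
    rw [e2] at h2
    -- Each inequality is multiplied by the other's parameter, so that the `J` terms cancel.
    have h3 := mul_le_mul_of_nonneg_left h1 hs.le
    have h4 := mul_le_mul_of_nonneg_left h2 ht.le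
    have e3 : s * (t / β * ((J v).toReal ^ β - (J u).toReal ^ β)) +
        t * (s / β * ((J u).toReal ^ β - (J v).toReal ^ β)) = 0 := by ring
    linarith

theorem forwardSolutions_eq_singleton (hconv : ConvexOn ℝ≥0 univ J) (hJ : AbsOneHomogeneous J)
    (hα : 2 ≤ α) (hβ : 1 ≤ β) (ht : 0 < t) {u : X}
    (hu : ∀ w, energy A J f α β t u ≤ energy A J f α β t w) :
    forwardSolutions A J f α β t = {A u} := by
  refine Subset.antisymm ?_ (singleton_subset_iff.2 ⟨u, hu, rfl⟩)
  rintro _ ⟨v, hv, rfl⟩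
  have h := minimizer_comparison hconv hJ hα hβ ht le_rfl hv hu
  rw [sub_self, zero_div, zero_mul] at h
  exact sub_eq_zero.1 (norm_le_zero_iff.1 h)

/-- At `t = 0` the convention `0 * ∞ = 0` removes `J` entirely, so the minimizers are all solutions
of `A v = f`, even those with `J v = ∞`. -/
theorem forwardSolutions_zero_eq_singleton (hα : 0 < α) (hR : RangeCondition A J f) :
    forwardSolutions A J f α β 0 = {f} := by
  obtain ⟨u, -, hu⟩ := hR
  have h0 : energy A J f α β 0 u = 0 := by simp [energy, hu, Real.zero_rpow hα.ne']
  refine Subset.antisymm ?_ (singleton_subset_iff.2 ⟨u, fun v => by rw [h0]; exact zero_le, hu⟩)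
  rintro _ ⟨v, hv, rfl⟩
  have h1 := hv u
  rw [h0] at h1
  have h2 : ENNReal.ofReal (‖A v - f‖ ^ α / α) ≤ 0 := le_self_add.trans h1
  have h3 : ‖A v - f‖ ^ α ≤ 0 := by
    have := ENNReal.ofReal_eq_zero.1 (le_antisymm h2 zero_le)
    rwa [div_le_iff₀ hα, zero_mul] at this
  have h4 : ‖A v - f‖ = 0 :=
    (Real.rpow_eq_zero (norm_nonneg _) hα.ne').1 (le_antisymm h3 (by positivity))
  exact sub_eq_zero.1 (norm_eq_zero.1 h4)

theorem minimizer_residual_le_norm (hJ : AbsOneHomogeneous J) (hα : 0 < α) (hβ : 1 ≤ β)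
    {u : X} (hu : ∀ w, energy A J f α β t u ≤ energy A J f α β t w) :
    ‖A u - f‖ ≤ ‖f‖ := by
  have h1 : ENNReal.ofReal (‖A u - f‖ ^ α / α) ≤ ENNReal.ofReal (‖f‖ ^ α / α) := by
    refine le_self_add.trans ((hu 0).trans ?_)
    simp [energy, hJ.map_zero, ENNReal.zero_rpow_of_pos (zero_lt_one.trans_le hβ)]
  rw [ENNReal.ofReal_le_ofReal_iff (by positivity), div_le_div_iff_of_pos_right hα] at h1
  exact (Real.rpow_le_rpow_iff (norm_nonneg _) (norm_nonneg _) hα).1 h1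

/-- With `A v = f` the inner product in the variational inequality is the squared residual.
Comparing energies directly would cost an extra factor `α`. -/
theorem minimizer_residual_rpow_le (hconv : ConvexOn ℝ≥0 univ J) (hJ : AbsOneHomogeneous J)
    (hα : 1 < α) (hβ : 1 ≤ β) (ht : 0 < t) {u : X}
    (hu : ∀ w, energy A J f α β t u ≤ energy A J f α β t w)
    {v : X} (hv : IsExactSolution A J f v) :
    ‖A u - f‖ ^ α ≤ t / β * ((J v).toReal ^ β - (J u).toReal ^ β) := by
  have h := minimizer_variational_inequality hconv hα hβ ht hu
    (minimizer_ne_top hJ hβ ht hu) hv.1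
  rwa [hv.2, real_inner_self_eq_norm_sq, norm_sub_rev f,
    rpow_sub_two_mul_sq (norm_nonneg _) (by linarith)] at h

theorem Jmin_nonneg : 0 ≤ Jmin A J f :=
  Real.sInf_nonneg (by rintro _ ⟨u, -, rfl⟩; exact ENNReal.toReal_nonneg)

theorem sStar_nonneg : 0 ≤ sStar A J f :=
  Real.sInf_nonneg (by rintro _ ⟨u, -, q, -, rfl⟩; exact norm_nonneg q)

/-- The residual bound under the range condition. -/
theorem minimizer_residual_le_constR (hconv : ConvexOn ℝ≥0 univ J) (hJ : AbsOneHomogeneous J)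
    (hα : 1 < α) (hβ : 1 ≤ β) (ht : 0 < t) {u : X}
    (hu : ∀ w, energy A J f α β t u ≤ energy A J f α β t w) (hR : RangeCondition A J f) :
    ‖A u - f‖ / t ≤ constR A J f α β * t ^ ((1 - α) / α) := by
  have hβ0 : 0 < β := zero_lt_one.trans_le hβ
  have hα0 : 0 < α := zero_lt_one.trans hα
  -- Taking the `β`-th root first makes the bound linear in `J v`, so the infimum can be taken.
  have h1 : (‖A u - f‖ ^ α / t) ^ β⁻¹ ≤ Jmin A J f := by
    refine le_csInf ?_ ?_
    · obtain ⟨v, hv⟩ := hR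
      exact ⟨_, v, hv, rfl⟩
    · rintro _ ⟨v, hv, rfl⟩
      rw [Real.rpow_inv_le_iff_of_pos (by positivity) ENNReal.toReal_nonneg hβ0, div_le_iff₀ ht]
      refine (minimizer_residual_rpow_le hconv hJ hα hβ ht hu hv).trans ?_
      have h2 : 0 ≤ (J u).toReal ^ β := by positivity
      have h3 : 0 ≤ (J v).toReal ^ β := by positivity
      have h4 : t / β ≤ t := div_le_self ht.le hβ
      calc t / β * ((J v).toReal ^ β - (J u).toReal ^ β) ≤ t / β * (J v).toReal ^ β := by
            gcongr; linarith
        _ ≤ t * (J v).toReal ^ β := by gcongr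
        _ = _ := mul_comm _ _
  rw [Real.rpow_inv_le_iff_of_pos (by positivity) Jmin_nonneg hβ0, div_le_iff₀ ht,
    ← Real.le_rpow_inv_iff_of_pos (norm_nonneg _)
      (mul_nonneg (Real.rpow_nonneg Jmin_nonneg _) ht.le) hα0,
    Real.mul_rpow (Real.rpow_nonneg Jmin_nonneg _) ht.le, ← Real.rpow_mul Jmin_nonneg] at h1
  rw [div_le_iff₀ ht, constR, mul_assoc, ← Real.rpow_add_one ht.ne']
  rwa [show (1 - α) / α + 1 = α⁻¹ by field_simp; ring, div_eq_mul_inv β]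

theorem toReal_add_inner_le_of_mem_subdifferential {u v : X} {q : H}
    (hq : adjointApply A q ∈ subdifferential J u) (hv : J v ≠ ⊤) :
    (J u).toReal + inner ℝ q (A v - A u) ≤ (J v).toReal := by
  obtain ⟨hu, h⟩ := hq
  have h1 := h v
  rw [← ENNReal.ofReal_toReal hu, ← ENNReal.ofReal_toReal hv, EReal.coe_ennreal_ofReal,
    EReal.coe_ennreal_ofReal, max_eq_left ENNReal.toReal_nonneg,
    max_eq_left ENNReal.toReal_nonneg] at h1
  have h2 : (adjointApply A q) (v - u) = inner ℝ q (A v - A u) := by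
    simp [adjointApply]
  rw [h2] at h1
  exact_mod_cast h1

/-- A subgradient of the form `A* q` vanishes on differences of exact solutions. -/
theorem Jmin_eq_of_mem_subdifferential {u : X} (hu : IsExactSolution A J f u) {q : H}
    (hq : adjointApply A q ∈ subdifferential J u) : Jmin A J f = (J u).toReal := by
  refine le_antisymm (csInf_le ⟨0, ?_⟩ ⟨u, hu, rfl⟩) (le_csInf ⟨_, u, hu, rfl⟩ ?_)
  · rintro _ ⟨v, -, rfl⟩
    exact ENNReal.toReal_nonneg
  · rintro _ ⟨v, hv, rfl⟩
    simpa [hu.2, hv.2] using toReal_add_inner_le_of_mem_subdifferential hq hv.1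

/-- The residual bound under the range and source conditions. -/
theorem minimizer_residual_le_constS (hconv : ConvexOn ℝ≥0 univ J) (hJ : AbsOneHomogeneous J)
    (hα : 1 < α) (hβ : 1 ≤ β) (ht : 0 < t) {u : X}
    (hu : ∀ w, energy A J f α β t u ≤ energy A J f α β t w) (hS : RangeSourceCondition A J f) :
    ‖A u - f‖ / t ≤ constS A J f α β * t ^ ((2 - α) / (α - 1)) := by
  have hβ0 : 0 < β := zero_lt_one.trans_le hβ
  have hα1 : 0 < α - 1 := by linarith
  have hM := Real.rpow_nonneg (Jmin_nonneg (A := A) (J := J) (f := f)) (β - 1)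
  have h1 : ‖A u - f‖ ^ (α - 1) ≤ sStar A J f * (t * Jmin A J f ^ (β - 1)) := by
    have hq : ∀ v : X, IsExactSolution A J f v → ∀ q : H,
        adjointApply A q ∈ subdifferential J v →
        ‖A u - f‖ ^ (α - 1) ≤ ‖q‖ * (t * Jmin A J f ^ (β - 1)) := by
      intro v hv q hq
      have huJ := minimizer_ne_top hJ hβ ht hu
      have h2 := minimizer_residual_rpow_le hconv hJ hα hβ ht hu hv
      have h3 := toReal_add_inner_le_of_mem_subdifferential hq huJ
      have h4 : (J v).toReal - (J u).toReal ≤ ‖q‖ * ‖A u - f‖ := by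
        have h5 := neg_le_of_abs_le (abs_real_inner_le_norm q (A u - A v))
        rw [hv.2] at h5 h3
        linarith
      have h6 := rpow_sub_rpow_le (x := (J v).toReal) (y := (J u).toReal)
        ENNReal.toReal_nonneg ENNReal.toReal_nonneg hβ
      rw [Jmin_eq_of_mem_subdifferential hv hq] at hM ⊢
      have h7 : ‖A u - f‖ ^ α ≤ ‖q‖ * (t * (J v).toReal ^ (β - 1)) * ‖A u - f‖ := by
        calc ‖A u - f‖ ^ α ≤ t / β * ((J v).toReal ^ β - (J u).toReal ^ β) := h2
          _ ≤ t / β * (β * (J v).toReal ^ (β - 1) * (‖q‖ * ‖A u - f‖)) := by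
              gcongr
              exact h6.trans (by gcongr)
          _ = _ := by field_simp
      rcases eq_or_lt_of_le (norm_nonneg (A u - f)) with h0 | h0
      · rw [← h0, Real.zero_rpow hα1.ne']
        positivity
      · refine le_of_mul_le_mul_right ?_ h0
        rwa [← Real.rpow_add_one h0.ne', sub_add_cancel]
    obtain ⟨v, hv, q, hvq⟩ := hS
    -- The infimum over `q` is taken after dividing by this factor; if it is zero, one source
    -- element suffices.
    rcases eq_or_lt_of_le (mul_nonneg ht.le hM) with h0 | h0
    · have := hq v hv q hvq
      rw [← h0] at this ⊢
      simpa using this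
    · rw [← div_le_iff₀ h0]
      refine le_csInf ⟨_, v, hv, q, hvq, rfl⟩ ?_
      rintro _ ⟨v', hv', q', hvq', rfl⟩
      rw [div_le_iff₀ h0]
      exact hq v' hv' q' hvq'
  rw [← Real.le_rpow_inv_iff_of_pos (norm_nonneg _)
      (mul_nonneg sStar_nonneg (mul_nonneg ht.le hM)) hα1,
    Real.mul_rpow sStar_nonneg (mul_nonneg ht.le hM), Real.mul_rpow ht.le hM,
    ← Real.rpow_mul Jmin_nonneg] at h1
  rw [div_le_iff₀ ht, constS, mul_assoc, ← Real.rpow_add_one ht.ne']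
  refine h1.trans (le_of_eq ?_)
  rw [show (2 - α) / (α - 1) + 1 = (α - 1)⁻¹ by field_simp; ring, one_div, ← div_eq_mul_inv]
  ring

end Minimizers

end VarReg

end

noncomputable section

namespace VarReg

/-! ### From increment bounds to derivative bounds -/

section Curves

variable {H : Type*} [NormedAddCommGroup H] [InnerProductSpace ℝ H]

theorem lipschitzOnWith_of_forall_le {E : Type*} [SeminormedAddCommGroup E] {g : ℝ → E} {S : Set ℝ} {L : ℝ≥0}
    (h : ∀ s ∈ S, ∀ t ∈ S, s ≤ t → ‖g t - g s‖ ≤ L * (t - s)) : LipschitzOnWith L g S := by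
  refine LipschitzOnWith.of_dist_le_mul fun x hx y hy => ?_
  rcases le_total x y with hxy | hxy
  · rw [dist_comm x, dist_comm (g x), dist_eq_norm, Real.dist_eq, abs_of_nonneg (by linarith)]
    exact h x hx y hy hxy
  · rw [dist_eq_norm, Real.dist_eq, abs_of_nonneg (by linarith)]
    exact h y hy x hx hxy

/-- A curve that is Lipschitz away from zero is differentiable almost everywhere on `(0, ∞)`. -/
theorem ae_differentiableAt_of_lipschitzOnWith_Ici [CompleteSpace H] {g : ℝ → H}
    (h : ∀ δ : ℝ, 0 < δ → ∃ L : ℝ≥0, LipschitzOnWith L g (Ici δ)) :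
    ∀ᵐ t ∂(volume.restrict (Ioi (0 : ℝ))), DifferentiableAt ℝ g t := by
  -- Freezing `g` below `1 / (n + 1)` gives a globally Lipschitz curve that agrees with `g` near
  -- every larger `t`.
  have hn : ∀ n : ℕ, ∀ᵐ t : ℝ, DifferentiableAt ℝ (fun r => g (max r (1 / ((n : ℝ) + 1)))) t := by
    intro n
    obtain ⟨L, hL⟩ := h (1 / ((n : ℝ) + 1)) (by positivity)
    have hmax : LipschitzWith 1 fun r : ℝ => max r (1 / ((n : ℝ) + 1)) :=
      LipschitzWith.id.max_const _
    have := hL.comp (hmax.lipschitzOnWith (s := univ)) fun r _ => mem_Ici.2 (le_max_right _ _)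
    exact ae_differentiableAt_of_lipschitzWith (lipschitzOnWith_univ.1 this)
  filter_upwards [ae_restrict_of_ae (ae_all_iff.2 hn), ae_restrict_mem measurableSet_Ioi]
    with t ht ht0
  obtain ⟨n, hnt⟩ := exists_nat_one_div_lt (mem_Ioi.1 ht0)
  refine (ht n).congr_of_eventuallyEq ?_
  filter_upwards [lt_mem_nhds hnt] with r hr
  rw [max_eq_left hr.le]

/-- Right difference quotients suffice; they keep the residual at the left endpoint `t` in the
bound. -/
theorem norm_deriv_le_of_forall_right {g : ℝ → H} {t c : ℝ} (hg : DifferentiableAt ℝ g t)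
    (h : ∀ r, t < r → ‖g r - g t‖ ≤ (r - t) * c) : ‖deriv g t‖ ≤ c := by
  refine le_of_tendsto hg.hasDerivAt.tendsto_slope_zero_right.norm ?_
  filter_upwards [self_mem_nhdsWithin] with r hr
  have hr0 : 0 < r := hr
  rw [norm_smul, norm_inv, Real.norm_of_nonneg hr0.le, inv_mul_le_iff₀ hr0]
  simpa using h (t + r) (by linarith)

end Curves

end VarReg

end

theorem mainTheorem6
    {Y H : Type*} [NormedAddCommGroup Y] [NormedSpace ℝ Y] [CompleteSpace Y]
    [TopologicalSpace.SeparableSpace Y]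
    [NormedAddCommGroup H] [InnerProductSpace ℝ H] [CompleteSpace H]
    (A : StrongDual ℝ Y →L[ℝ] H) (J : StrongDual ℝ Y → ℝ≥0∞)
    (hJ_convex : ConvexOn ℝ≥0 univ J)
    (hJ_hom : VarReg.AbsOneHomogeneous J)
    (hJ_proper : ∃ u, J u ≠ ⊤)
    (hJ_lsc : VarReg.WeakStarLSC J)
    (hA_norm : VarReg.NormEquivOnKernel A J)
    (hA_poincare : VarReg.PoincareInequality A J)
    (hA_cont : VarReg.WeakStarToWeakContinuous A)
    (f : H) (α β : ℝ) (hα : 2 ≤ α) (hβ : 1 ≤ β) :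
    -- `g` is the forward solution path, `g t = A u_t`
    ∃ g : ℝ → H,
      (∀ t : ℝ, 0 < t → VarReg.forwardSolutions A J f α β t = {g t}) ∧
      (∀ δ : ℝ, 0 < δ → ∃ L : ℝ≥0, LipschitzOnWith L g (Ioi δ)) ∧
      (∀ᵐ t ∂(volume.restrict (Ioi (0 : ℝ))),
        DifferentiableAt ℝ g t ∧
        ‖deriv g t‖ ≤ ‖g t - f‖ / t ∧
        ‖g t - f‖ / t ≤ ‖f‖ / t) ∧
      (VarReg.RangeCondition A J f →
        ∀ᵐ t ∂(volume.restrict (Ioi (0 : ℝ))),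
          ‖deriv g t‖ ≤ VarReg.constR A J f α β * t ^ ((1 - α) / α)) ∧
      (VarReg.RangeSourceCondition A J f →
        ∀ᵐ t ∂(volume.restrict (Ioi (0 : ℝ))),
          ‖deriv g t‖ ≤ VarReg.constS A J f α β * t ^ ((2 - α) / (α - 1))) ∧
      (α = 2 → VarReg.RangeSourceCondition A J f →
        VarReg.forwardSolutions A J f α β 0 = {g 0} ∧
        ∃ L : ℝ≥0, LipschitzOnWith L g (Ici 0)) := by
  have hα0 : 0 < α := by linarith
  have hα1 : 1 < α := by linarith
  choose! U hU using fun t (ht : (0 : ℝ) < t) => VarReg.exists_minimizer hJ_convex hJ_hom hJ_lsc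
    hA_norm hA_poincare hA_cont f hα0 hβ ht
  -- The value `f` is the forward solution at `t = 0` when the range condition holds.
  set g : ℝ → H := fun t => if 0 < t then A (U t) else f with hg
  have hgpos : ∀ t, 0 < t → g t = A (U t) := fun t ht => if_pos ht
  have hg0 : g 0 = f := if_neg (lt_irrefl 0)
  have hcomp : ∀ s t, 0 < s → s ≤ t → ‖g t - g s‖ ≤ (t - s) * (‖g s - f‖ / s) := by
    intro s t hs hst
    rw [hgpos s hs, hgpos t (hs.trans_le hst)]
    refine (VarReg.minimizer_comparison hJ_convex hJ_hom hα hβ hs hst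
      (hU t (hs.trans_le hst)) (hU s hs)).trans (le_of_eq ?_)
    ring
  have hnorm : ∀ t, 0 < t → ‖g t - f‖ ≤ ‖f‖ := fun t ht => by
    rw [hgpos t ht]
    exact VarReg.minimizer_residual_le_norm hJ_hom hα0 hβ (hU t ht)
  have hLip : ∀ (δ : ℝ) (hδ : 0 < δ), LipschitzOnWith (‖f‖₊ / NNReal.mk δ hδ.le) g (Ici δ) := by
    intro δ hδ
    refine VarReg.lipschitzOnWith_of_forall_le fun s hs t _ hst => ?_
    have hs0 : 0 < s := hδ.trans_le hs
    refine (hcomp s t hs0 hst).trans ?_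
    rw [mul_comm]
    refine mul_le_mul_of_nonneg_right ?_ (by linarith)
    exact div_le_div₀ (norm_nonneg f) (hnorm s hs0) hδ hs
  have hdiff : ∀ᵐ t ∂(volume.restrict (Ioi (0 : ℝ))),
      0 < t ∧ DifferentiableAt ℝ g t ∧ ‖deriv g t‖ ≤ ‖g t - f‖ / t := by
    filter_upwards [VarReg.ae_differentiableAt_of_lipschitzOnWith_Ici
      fun δ hδ => ⟨_, hLip δ hδ⟩, ae_restrict_mem measurableSet_Ioi] with t ht ht0
    exact ⟨ht0, ht, VarReg.norm_deriv_le_of_forall_right ht fun r hr => hcomp t r ht0 hr.le⟩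
  refine ⟨g, fun t ht => ?_, fun δ hδ => ⟨_, (hLip δ hδ).mono Ioi_subset_Ici_self⟩, ?_,
    fun hR => ?_, fun hS => ?_, ?_⟩
  · rw [hgpos t ht]
    exact VarReg.forwardSolutions_eq_singleton hJ_convex hJ_hom hα hβ ht (hU t ht)
  · filter_upwards [hdiff] with t ht
    exact ⟨ht.2.1, ht.2.2, div_le_div_of_nonneg_right (hnorm t ht.1) ht.1.le⟩
  · filter_upwards [hdiff] with t ht
    refine ht.2.2.trans ?_
    rw [hgpos t ht.1]
    exact VarReg.minimizer_residual_le_constR hJ_convex hJ_hom hα1 hβ ht.1 (hU t ht.1) hR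
  · filter_upwards [hdiff] with t ht
    refine ht.2.2.trans ?_
    rw [hgpos t ht.1]
    exact VarReg.minimizer_residual_le_constS hJ_convex hJ_hom hα1 hβ ht.1 (hU t ht.1) hS
  · rintro rfl hS
    obtain ⟨v, hv, -⟩ := id hS
    refine ⟨by rw [hg0]; exact VarReg.forwardSolutions_zero_eq_singleton hα0 ⟨v, hv⟩, ?_⟩
    -- For `α = 2` the exponent of `t` is zero, so this bound is uniform in `t`.
    have hres : ∀ t, 0 < t → ‖g t - f‖ / t ≤ VarReg.constS A J f 2 β := fun t ht => by
      rw [hgpos t ht]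
      simpa using
        VarReg.minimizer_residual_le_constS hJ_convex hJ_hom hα1 hβ ht (hU t ht) hS
    have hC : 0 ≤ VarReg.constS A J f 2 β :=
      (div_nonneg (norm_nonneg _) zero_le_one).trans (hres 1 zero_lt_one)
    refine ⟨NNReal.mk _ hC, VarReg.lipschitzOnWith_of_forall_le fun s hs t _ hst => ?_⟩
    change _ ≤ VarReg.constS A J f 2 β * (t - s)
    rw [mul_comm]
    -- At `s = 0` the increment `g t - g 0` is the residual itself.
    rcases eq_or_lt_of_le (mem_Ici.1 hs) with rfl | hs0
    · rcases eq_or_lt_of_le hst with rfl | ht0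
      · simp
      · rw [hg0, sub_zero, mul_comm, ← div_le_iff₀ ht0]
        exact hres t ht0
    · refine (hcomp s t hs0 hst).trans ?_
      exact mul_le_mul_of_nonneg_left (hres s hs0) (by linarith)
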